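/- Let $n\ge 0$ and let $B:\mathfrak{gl}(n,\mathbb C)\to\mathfrak{gl}(n,\mathbb C)$ be a (real) $C^\infty$ map. Write $T^*GL(n,\mathbb C)=\{(Q,P): Q\in GL(n,\mathbb C),\ P\in\mathfrak{gl}(n,\mathbb C)\}$, $\mu(Q,P)=Q^\dagger P$, and $G\cdot(Q,P)=(GQ,(G^{-1})^\dagger P)$ for $G\in GL(n,\mathbb C)$. Consider the isospectral flow $$\dot W=[B(W),W]$$ and the lifted system $$\dot Q=Q\,B(Q^\dagger P)^\dagger,\qquad \dot P=-P\,B(Q^\dagger P). \qquad (*)$$ Let $\sum_{k\ge 0}h^k c_k(Q,P)$, with $c_0(Q,P)=(Q,P)$, be the B-series of $(*)$ with real coefficients $a(\tau)$, i.e. the formal series $z+\sum_\tau \frac{h^{|\tau|}}{\sigma(\tau)}a(\tau)F(\tau)(z)$ over rooted trees $\tau$, where $\sigma(\tau)$ is the symmetry coefficient and $F(\tau)$ the elementary differential; or let it be the P-series of $(*)$, partitioned into $Q$ and $P$, the sum being then over rooted trees with two-coloured vertices. Suppose that this B-series (P-series) is symplectic: for every $d$ and every smooth $H:\mathbb R^{2d}\to\mathbb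 R$, the B-series (P-series, partitioned into $q$ and $p$) with the same coefficients $a$ of the canonical Hamiltonian system of $H$ is a symplectic map, as an identity of formal power series in $h$. Let $\Phi_h:D_h\to T^*GL(n,\mathbb C)$, $D_h\subseteq T^*GL(n,\mathbb C)$, be a family of maps such that every point of $T^*GL(n,\mathbb C)$ lies in $D_h$ for all sufficiently small $h>0$. Suppose that $\Phi_h$ is equivariant: for all $G\in GL(n,\mathbb C)$ and $(Q,P)\in D_h$ one has $G\cdot(Q,P)\in D_h$ and $\Phi_h(G\cdot (Q,P))=G\cdot\Phi_h(Q,P)$. That $\Phi_h$ is the B-series (P-series) method with the above series is understood in one of two senses: (A) $\Phi_h(z)=\sum_k h^kc_k(z)$, as a convergent series, for all $h$ and all $z\in D_h$; (B) $\Phi_h(z)=\sum_{k<N}h^kc_k(z)+O(h^N)$ as $h\to0^+$, for all $z\in T^*GL(n,\mathbb C)$ and all $N$. Then there are maps $\phi_h$ on $\mathfrak{gl}(n,\mathbb C)$, the same in all that follows, such that: 1. $\Phi_h$ descends to $\phi_h$: $\phi_h(\mu(z))=\mu(\Phi_h(z))$ for all $h$ and all $z\in D_h$. If $\Phi_h$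 is consistent with $(*)$, i.e. $\Phi_h(z)=z+hf(z)+o(h)$ as $h\to0^+$ for each $z\in T^*GL(n,\mathbb C)$, where $f$ is the right-hand side of $(*)$, then $\phi_h$ is consistent with the isospectral flow: $\phi_h(W)=W+h[B(W),W]+o(h)$ for each $W$. Moreover $\phi_h$ is isospectral. In case (A), $\phi_h(W)$ and $W$ have the same characteristic polynomial for all $h$ and all $W\in\mu(D_h)$. In case (B), for each $W$ the coefficients of the two characteristic polynomials differ by $O(h^N)$ as $h\to 0^+$, for every $N$. 2. Let $S\subseteq\mathfrak{gl}(n,\mathbb C)$ be a real linear subspace, and suppose that $B(W)\in\mathfrak n(S)=\{\xi:[\xi,S]\subseteq S\}$ for all $W$ in an $\varepsilon$-neighbourhood of $S$, for some $\varepsilon>0$. Put $N(S)=\{g\in GL(n,\mathbb C): g^{-1}Sg\subseteq S\}$ and $\mathcal F_G=\{Q\in GL(n,\mathbb C): GQ^\dagger\in N(S)\}$ for $G\in GL(n,\mathbb C)$. Suppose that $\Phi_h$ preserves this foliation over $S$: whenever $(Q,P)\in D_h$, $Q^\dagger P\in S$ and $Q\in\mathcal F_G$, the first component of $\Phi_h(Q,P)$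 is in $\mathcal F_G$. Then $\phi_h$ restricts to $S$. In case (A), $\phi_h(W)\in S$ for all $h$ and all $W\in S\cap\mu(D_h)$. In case (B), for each $W\in S$ the distance from $\phi_h(W)$ to $S$ is $O(h^N)$ as $h\to 0^+$, for every $N$. -/

import Mathlib

open Filter Topology Asymptotics
open scoped ContDiff Matrix

/-! ### Rooted trees, elementary differentials, B-series and P-series

Trees carry a colour in `κ` at every vertex: one colour gives the trees of B-series, two colours
give the trees of P-series. -/

/-- Planar rooted trees with vertices coloured by `κ`. -/
inductive PlanarTree (κ : Type) : Type
  | node (c : κ) (m : ℕ) (ch : Fin m → PlanarTree κ) : PlanarTree κ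

namespace PlanarTree

variable {κ : Type}

/-- Two planar trees are isomorphic as (unordered) coloured rooted trees. -/
inductive Iso : PlanarTree κ → PlanarTree κ → Prop
  | node (c : κ) (m : ℕ) (ch ch' : Fin m → PlanarTree κ) (e : Equiv.Perm (Fin m))
      (h : ∀ i, Iso (ch i) (ch' (e i))) : Iso (node c m ch) (node c m ch')

theorem Iso.refl : ∀ t : PlanarTree κ, Iso t t
  | .node c m ch => Iso.node c m ch ch (Equiv.refl _) (fun i => Iso.refl (ch i))

theorem Iso.symm {s t : PlanarTree κ} (h : Iso s t) : Iso t s := by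
  induction h with
  | node c m ch ch' e _ ih =>
    refine Iso.node c m ch' ch e.symm (fun i => ?_)
    have := ih (e.symm i)
    rwa [Equiv.apply_symm_apply] at this

theorem Iso.trans {s t : PlanarTree κ} (h : Iso s t) : ∀ {u : PlanarTree κ}, Iso t u → Iso s u := by
  induction h with
  | node c m ch ch' e _ ih =>
    intro u hu
    cases hu with
    | node _ _ _ ch'' e' h' =>
      exact Iso.node c m ch ch'' (e.trans e') (fun i => ih i (h' (e i)))

instance isoSetoid (κ : Type) : Setoid (PlanarTree κ) :=
  ⟨Iso, Iso.refl, Iso.symm, fun h h' => Iso.trans h h'⟩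

/-- The number of vertices. -/
def order : PlanarTree κ → ℕ
  | .node _ m ch => 1 + ∑ i : Fin m, order (ch i)

/-- The product over all vertices of the factorial of the number of children. A rooted tree `τ`
with symmetry coefficient `σ(τ)` has exactly `weight / σ(τ)` planar representatives. -/
def weight : PlanarTree κ → ℕ
  | .node _ m ch => m.factorial * ∏ i : Fin m, weight (ch i)

theorem finite_order_le [Finite κ] (k : ℕ) : {t : PlanarTree κ | t.order ≤ k}.Finite := by
  induction k with
  | zero =>
    refine Set.Finite.subset Set.finite_empty ?_
    rintro ⟨c, m, ch⟩ h
    simp [order] at h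
  | succ k ih =>
    have : Finite {t : PlanarTree κ | t.order ≤ k} := ih
    refine (Set.finite_range (fun p : κ × (Σ m : Fin (k + 1), Fin m →
      {t : PlanarTree κ | t.order ≤ k}) => node p.1 p.2.1 (fun i => (p.2.2 i).1))).subset ?_
    rintro ⟨c, m, ch⟩ h
    have h' : ∑ i, (ch i).order ≤ k := by
      simp only [Set.mem_ofPred_eq, order] at h; omega
    have hch : ∀ i, (ch i).order ≤ k := fun i =>
      (Finset.single_le_sum (f := fun i => (ch i).order) (fun _ _ => Nat.zero_le _)
        (Finset.mem_univ i)).trans h'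
    have hpos : ∀ t : PlanarTree κ, 1 ≤ t.order := by
      rintro ⟨c, m, ch⟩; simp [order]
    have hm : m < k + 1 := by
      have : ∑ _i : Fin m, 1 ≤ ∑ i, (ch i).order := Finset.sum_le_sum fun i _ => hpos _
      simp at this; omega
    exact ⟨(c, ⟨⟨m, hm⟩, fun i => ⟨ch i, hch i⟩⟩), rfl⟩

theorem finite_order_eq (κ : Type) [Finite κ] (k : ℕ) : {t : PlanarTree κ | t.order = k}.Finite :=
  (finite_order_le k).subset fun _ h => le_of_eq h

/-- The finitely many planar trees with `k` vertices. -/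
noncomputable def ofOrder (κ : Type) [Finite κ] (k : ℕ) : Finset (PlanarTree κ) :=
  (finite_order_eq κ k).toFinset

/-- The elementary differential of a tree: if the root has colour `c` and the subtrees at the root
are `t₁, …, tₘ`, it is `y ↦ f_c⁽ᵐ⁾(y)(F(t₁)(y), …, F(tₘ)(y))`. -/
noncomputable def elemDiff {E : Type} [NormedAddCommGroup E] [NormedSpace ℝ E] (f : κ → E → E) :
    PlanarTree κ → E → E
  | .node c m ch => fun y => iteratedFDeriv ℝ m (f c) y (fun i => elemDiff f (ch i) y)

end PlanarTree

/-- Coloured rooted trees (the children of a vertex are not ordered). -/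
def ColoredTree (κ : Type) : Type := Quotient (PlanarTree.isoSetoid κ)

/-- The coefficient of `h ^ k` in the series
`y + ∑_τ h ^ |τ| / σ(τ) * a(τ) * F(τ)(y)`, the sum being over all coloured rooted trees `τ`.
It is written as a sum over planar representatives: all representatives of `τ` have the same
elementary differential, and their number is `weight / σ(τ)`. -/
noncomputable def treeSeries {κ : Type} [Finite κ] {E : Type} [NormedAddCommGroup E]
    [NormedSpace ℝ E] (a : ColoredTree κ → ℝ) (f : κ → E → E) : ℕ → E → E
  | 0 => fun y => y
  | k + 1 => fun y => ∑ t ∈ PlanarTree.ofOrder κ (k + 1),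
      (a (Quotient.mk (PlanarTree.isoSetoid κ) t) / (t.weight : ℝ)) • PlanarTree.elemDiff f t y

/-- The B-series with coefficients `a` of the system `y' = f(y)`, as the sequence of its
coefficients at the powers of the step size. -/
noncomputable def bSeries {E : Type} [NormedAddCommGroup E] [NormedSpace ℝ E]
    (a : ColoredTree Unit → ℝ) (f : E → E) : ℕ → E → E :=
  treeSeries a (fun _ => f)

/-- The two parts of a partitioned vector field: `true` for the first component, `false` for the
second. -/
def partitionField {E F : Type} [Zero E] [Zero F] (f : E × F → E × F) : Bool → E × F → E × F
  | true => fun z => ((f z).1, 0)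
  | false => fun z => (0, (f z).2)

/-- The P-series with coefficients `a` of the partitioned system `q' = f₁(q, p)`, `p' = f₂(q, p)`,
as the sequence of its coefficients at the powers of the step size. -/
noncomputable def pSeries {E F : Type} [NormedAddCommGroup E] [NormedSpace ℝ E]
    [NormedAddCommGroup F] [NormedSpace ℝ F]
    (a : ColoredTree Bool → ℝ) (f : E × F → E × F) : ℕ → E × F → E × F :=
  treeSeries a (partitionField f)

/-! ### Symplectic B-series and P-series -/

/-- Canonical coordinates `(q, p)` on `ℝ²ᵈ`. -/
abbrev CanonicalSpace (d : ℕ) : Type := (Fin d → ℝ) × (Fin d → ℝ)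

/-- The canonical symplectic form `∑ dqᵢ ∧ dpᵢ`. -/
def canonicalForm {d : ℕ} (u v : CanonicalSpace d) : ℝ :=
  ∑ i, (u.1 i * v.2 i - u.2 i * v.1 i)

/-- The Hamiltonian vector field `q' = ∂H/∂p`, `p' = -∂H/∂q`. -/
noncomputable def hamiltonianField {d : ℕ} (H : CanonicalSpace d → ℝ) (z : CanonicalSpace d) :
    CanonicalSpace d :=
  (fun i => fderiv ℝ H z (0, Pi.single i 1), fun i => -fderiv ℝ H z (Pi.single i 1, 0))

/-- The map `Ψ_h = ∑ hᵏ cₖ` is symplectic, as an identity of formal power series in `h`: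
`ω(Ψ_h'(z) u, Ψ_h'(z) v) = ω(u, v)`. -/
def IsFormallySymplectic {d : ℕ} (c : ℕ → CanonicalSpace d → CanonicalSpace d) : Prop :=
  ∀ (z u v : CanonicalSpace d) (k : ℕ),
    ∑ p ∈ Finset.HasAntidiagonal.antidiagonal k,
        canonicalForm (fderiv ℝ (c p.1) z u) (fderiv ℝ (c p.2) z v) =
      if k = 0 then canonicalForm u v else 0

/-- A B-series is symplectic if it is so for every canonical Hamiltonian system. -/
def IsSymplecticBSeries (a : ColoredTree Unit → ℝ) : Prop :=
  ∀ (d : ℕ) (H : CanonicalSpace d → ℝ), ContDiff ℝ ∞ H →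
    IsFormallySymplectic (bSeries a (hamiltonianField H))

/-- A P-series is symplectic if it is so for every canonical Hamiltonian system, partitioned into
positions and momenta. -/
def IsSymplecticPSeries (a : ColoredTree Bool → ℝ) : Prop :=
  ∀ (d : ℕ) (H : CanonicalSpace d → ℝ), ContDiff ℝ ∞ H →
    IsFormallySymplectic (pSeries a (hamiltonianField H))

/-- `c` is the sequence of coefficients of a symplectic B-series, or of a symplectic P-series, of
the (partitioned) system `z' = f(z)`. -/
def IsSymplecticSeriesOf {E F : Type} [NormedAddCommGroup E] [NormedSpace ℝ E]
    [NormedAddCommGroup F] [NormedSpace ℝ F]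
    (f : E × F → E × F) (c : ℕ → E × F → E × F) : Prop :=
  (∃ a : ColoredTree Unit → ℝ, IsSymplecticBSeries a ∧ c = bSeries a f) ∨
    (∃ a : ColoredTree Bool → ℝ, IsSymplecticPSeries a ∧ c = pSeries a f)

/-- The map `Φ_h`, on its domain `D h`, is the sum of the convergent series `∑ hᵏ cₖ`. -/
def IsSumOfSeries {E : Type} [NormedAddCommGroup E] [NormedSpace ℝ E]
    (D : ℝ → Set E) (Φ : ℝ → E → E) (c : ℕ → E → E) : Prop :=
  ∀ h, ∀ z ∈ D h, HasSum (fun k => h ^ k • c k z) (Φ h z)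

/-- The map `Φ_h` has the asymptotic expansion `∑ hᵏ cₖ` as `h → 0+`, at every point of `X`. -/
def HasAsymptoticSeries {E : Type} [NormedAddCommGroup E] [NormedSpace ℝ E]
    (X : Set E) (Φ : ℝ → E → E) (c : ℕ → E → E) : Prop :=
  ∀ z ∈ X, ∀ N : ℕ,
    (fun h => Φ h z - ∑ k ∈ Finset.range N, h ^ k • c k z) =O[𝓝[>] 0] (fun h : ℝ => h ^ N)

/-- `Φ_h` is consistent with `z' = f(z)` on `X`: `Φ_h(z) = z + h f(z) + o(h)` as `h → 0+`. -/
def IsConsistentOn {E : Type} [NormedAddCommGroup E] [NormedSpace ℝ E]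
    (X : Set E) (f : E → E) (Φ : ℝ → E → E) : Prop :=
  ∀ z ∈ X, (fun h => Φ h z - z - h • f z) =o[𝓝[>] 0] (fun h : ℝ => h)

/-! ### Isospectral flows and their lift -/

/-- The space `gl(n, ℂ)`. It is used as a finite-dimensional real vector space; the norm
(the maximum of the moduli of the entries) only serves to speak of limits and derivatives. -/
abbrev GLie (n : ℕ) : Type := Matrix (Fin n) (Fin n) ℂ

attribute [local instance] Matrix.normedAddCommGroup Matrix.normedSpace

/-- `T^*GL(n, ℂ)`: the pairs `(Q, P)` with `Q` invertible. -/
def cotangentGL (n : ℕ) : Set (GLie n × GLie n) := {z | IsUnit z.1}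

/-- The left action `G · (Q, P) = (GQ, (G⁻¹)† P)`. -/
def leftAction {n : ℕ} (G : GL (Fin n) ℂ) (z : GLie n × GLie n) : GLie n × GLie n :=
  ((G : GLie n) * z.1, ((G⁻¹ : GL (Fin n) ℂ) : GLie n)ᴴ * z.2)

/-- The momentum map `(Q, P) ↦ Q† P`. -/
def momentum {n : ℕ} (z : GLie n × GLie n) : GLie n := z.1ᴴ * z.2

/-- The right-hand side `[B(W), W]` of the isospectral flow. -/
def isospectralField {n : ℕ} (B : GLie n → GLie n) (W : GLie n) : GLie n := B W * W - W * B W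

/-- The lifted system `Q' = Q B(Q† P)†`, `P' = -P B(Q† P)`. -/
def liftedField {n : ℕ} (B : GLie n → GLie n) (z : GLie n × GLie n) : GLie n × GLie n :=
  (z.1 * (B (momentum z))ᴴ, -(z.2 * B (momentum z)))

/-- The normalizer `N(S) = {g ∈ GL(n, ℂ) | g⁻¹ S g ⊆ S}`. -/
def groupNormalizer {n : ℕ} (S : Submodule ℝ (GLie n)) : Set (GLie n) :=
  {g | IsUnit g ∧ ∀ X ∈ S, g⁻¹ * X * g ∈ S}

/-- The normalizer `𝔫(S) = {ξ ∈ gl(n, ℂ) | [ξ, S] ⊆ S}`. -/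
def lieNormalizer {n : ℕ} (S : Submodule ℝ (GLie n)) : Set (GLie n) :=
  {ξ | ∀ X ∈ S, ξ * X - X * ξ ∈ S}

/-- The leaf `{Q | G Q† ∈ N(S)}`. -/
def leaf {n : ℕ} (S : Submodule ℝ (GLie n)) (G : GL (Fin n) ℂ) : Set (GLie n) :=
  {Q | (G : GLie n) * Qᴴ ∈ groupNormalizer S}

/-! The lifted system has the invariant `P Q†`, and a symplectic B- or P-series preserves every
invariant bilinear in the two components. Start from `(1, W)` and write `(Q, P) = Φ_h(1, W)`: then
`P Q† = W`, exactly or up to `O(h^N)`. Hence `Q† P` has the characteristic polynomial of `W`, and it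
is the conjugate `g W g⁻¹` with `g = Q†`, up to the same error. By equivariance `μ ∘ Φ_h` depends on
`μ` alone, so `φ_h(W) = μ(Φ_h(1, W))`. Preservation of the leaf through the identity says that `Q†`
lies in `N(S)`, so conjugation by it maps `S` into itself.

The lifted system is not assumed Hamiltonian in canonical form, so conservation
(`IsSymplecticSeriesOf.sum_antidiagonal_eq`) is derived from symplecticity by a cotangent lift. Any
field `f` on `X × Y` lifts to the Hamiltonian `H = ⟨fibre, f(base)⟩`. If `I(x, y) = D(x, y)` is an
invariant, its differential is a linear section of the lift that intertwines `f` with the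
Hamiltonian field (`liftIncl_intertwines`); scaling the fibres commutes with that field
(`fibreScale_intertwines`). Tree series commute with linear intertwiners (`map_treeSeries`), so the
series of `H` respects both. The symplectic form, evaluated on a vector tangent to the section and a
fibre vector, is then the differential of `I`, and symplecticity says that the coefficients of `I(∑
hᵏ cₖ)` with `k > 0` have zero derivative. They vanish at the origin, hence everywhere. -/

section TreeSeries

variable {κ : Type} {E F : Type} [NormedAddCommGroup E] [NormedSpace ℝ E]
  [NormedAddCommGroup F] [NormedSpace ℝ F]

/-! ### Naturality of tree series under linear maps. -/

theorem PlanarTree.differentiable_elemDiff {f : κ → E → E} (hf : ∀ c, ContDiff ℝ ∞ (f c)) :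
    ∀ t : PlanarTree κ, Differentiable ℝ (t.elemDiff f)
  | .node c m ch => by
    intro y
    have h1 : Differentiable ℝ (iteratedFDeriv ℝ m (f c)) :=
      (hf c).differentiable_iteratedFDeriv (by exact_mod_cast ENat.natCast_lt_top m)
    have h2 := fun i => PlanarTree.differentiable_elemDiff hf (ch i) y
    exact ((h1 y).hasFDerivAt.continuousMultilinearMap_apply
      fun i => (h2 i).hasFDerivAt).differentiableAt

/-- Differentiating `L ∘ f c = g c ∘ L` repeatedly moves `L` past each derivative and onto its
arguments; induction on the tree then treats the subtrees. -/
theorem PlanarTree.map_elemDiff {f : κ → E → E} {g : κ → F → F} (hf : ∀ c, ContDiff ℝ ∞ (f c))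
    (hg : ∀ c, ContDiff ℝ ∞ (g c)) (L : E →L[ℝ] F) (h : ∀ c y, L (f c y) = g c (L y)) :
    ∀ (t : PlanarTree κ) (y : E), L (t.elemDiff f y) = t.elemDiff g (L y)
  | .node c m ch => by
    intro y
    have hm : (m : WithTop ℕ∞) ≤ ∞ := by exact_mod_cast le_top
    have hcomp : (L ∘ f c) = g c ∘ L := funext (h c)
    have h1 := L.iteratedFDeriv_comp_left (i := m) ((hf c).contDiffAt (x := y)) hm
    have h2 := L.iteratedFDeriv_comp_right (hg c) y hm
    rw [hcomp, h2] at h1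
    have h3 := congrArg (fun T => T (fun i => (ch i).elemDiff f y)) h1
    simp only [ContinuousMultilinearMap.compContinuousLinearMap_apply,
      ContinuousLinearMap.compContinuousMultilinearMap_coe, Function.comp_apply,
      fun i => PlanarTree.map_elemDiff hf hg L h (ch i) y] at h3
    exact h3.symm

variable [Finite κ] (a : ColoredTree κ → ℝ)

theorem differentiable_treeSeries {f : κ → E → E} (hf : ∀ c, ContDiff ℝ ∞ (f c)) (k : ℕ) :
    Differentiable ℝ (treeSeries a f k) := by
  cases k with
  | zero => exact differentiable_id
  | succ k =>
    exact Differentiable.fun_sum fun t _ => (t.differentiable_elemDiff hf).const_smul _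

theorem map_treeSeries {f : κ → E → E} {g : κ → F → F} (hf : ∀ c, ContDiff ℝ ∞ (f c))
    (hg : ∀ c, ContDiff ℝ ∞ (g c)) (L : E →L[ℝ] F) (h : ∀ c y, L (f c y) = g c (L y))
    (k : ℕ) (y : E) : L (treeSeries a f k y) = treeSeries a g k (L y) := by
  cases k with
  | zero => rfl
  | succ k => simp [treeSeries, PlanarTree.map_elemDiff hf hg L h]

end TreeSeries

/-! ### A common framework for B-series and P-series. -/

/-- An assignment of a formal power series of maps to each smooth partitioned vector field that
starts with the identity and commutes with block diagonal linear maps. -/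
structure IsNaturalSeries (S : ∀ (E F : Type) [NormedAddCommGroup E] [NormedSpace ℝ E]
    [NormedAddCommGroup F] [NormedSpace ℝ F], (E × F → E × F) → ℕ → E × F → E × F) : Prop where
  zero : ∀ (E F : Type) [NormedAddCommGroup E] [NormedSpace ℝ E]
    [NormedAddCommGroup F] [NormedSpace ℝ F] (f : E × F → E × F) (z : E × F), S E F f 0 z = z
  differentiable : ∀ (E F : Type) [NormedAddCommGroup E] [NormedSpace ℝ E]
    [NormedAddCommGroup F] [NormedSpace ℝ F] (f : E × F → E × F), ContDiff ℝ ∞ f →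
    ∀ k, Differentiable ℝ (S E F f k)
  map : ∀ (E F E' F' : Type) [NormedAddCommGroup E] [NormedSpace ℝ E]
    [NormedAddCommGroup F] [NormedSpace ℝ F] [NormedAddCommGroup E'] [NormedSpace ℝ E']
    [NormedAddCommGroup F'] [NormedSpace ℝ F'] (f : E × F → E × F) (g : E' × F' → E' × F'),
    ContDiff ℝ ∞ f → ContDiff ℝ ∞ g → ∀ (L₁ : E →L[ℝ] E') (L₂ : F →L[ℝ] F'),
    (∀ z, L₁.prodMap L₂ (f z) = g (L₁.prodMap L₂ z)) → ∀ k z,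
    L₁.prodMap L₂ (S E F f k z) = S E' F' g k (L₁.prodMap L₂ z)

theorem isNaturalSeries_bSeries (a : ColoredTree Unit → ℝ) :
    IsNaturalSeries (fun _ _ _ _ _ _ f => bSeries a f) where
  zero _ _ _ _ _ _ _ _ := rfl
  differentiable _ _ _ _ _ _ _ hf k := differentiable_treeSeries a (fun _ => hf) k
  map _ _ _ _ _ _ _ _ _ _ _ _ _ _ hf hg L₁ L₂ h k z :=
    map_treeSeries a (fun _ => hf) (fun _ => hg) (L₁.prodMap L₂) (fun _ => h) k z

theorem contDiff_partitionField {E F : Type} [NormedAddCommGroup E] [NormedSpace ℝ E]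
    [NormedAddCommGroup F] [NormedSpace ℝ F] {f : E × F → E × F} (hf : ContDiff ℝ ∞ f) :
    ∀ c, ContDiff ℝ ∞ (partitionField f c)
  | true => hf.fst.prodMk contDiff_const
  | false => contDiff_const.prodMk hf.snd

theorem isNaturalSeries_pSeries (a : ColoredTree Bool → ℝ) :
    IsNaturalSeries (fun _ _ _ _ _ _ f => pSeries a f) where
  zero _ _ _ _ _ _ _ _ := rfl
  differentiable _ _ _ _ _ _ _ hf k :=
    differentiable_treeSeries a (contDiff_partitionField hf) k
  map _ _ _ _ _ _ _ _ _ _ _ _ f g hf hg L₁ L₂ h k z := by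
    refine map_treeSeries a (contDiff_partitionField hf) (contDiff_partitionField hg)
      (L₁.prodMap L₂) (fun c y => ?_) k z
    have := h y
    rw [Prod.ext_iff] at this
    cases c
    · exact Prod.ext (map_zero L₁) this.2
    · exact Prod.ext this.1 (map_zero L₂)

theorem IsSymplecticSeriesOf.exists_isNaturalSeries {E F : Type} [NormedAddCommGroup E]
    [NormedSpace ℝ E] [NormedAddCommGroup F] [NormedSpace ℝ F]
    {f : E × F → E × F} {c : ℕ → E × F → E × F} (hc : IsSymplecticSeriesOf f c) :
    ∃ S : ∀ (E F : Type) [NormedAddCommGroup E] [NormedSpace ℝ E]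
      [NormedAddCommGroup F] [NormedSpace ℝ F], (E × F → E × F) → ℕ → E × F → E × F,
      IsNaturalSeries S ∧ (∀ (d : ℕ) (H : CanonicalSpace d → ℝ), ContDiff ℝ ∞ H →
        IsFormallySymplectic (S _ _ (hamiltonianField H))) ∧ c = S _ _ f := by
  rcases hc with ⟨a, ha, rfl⟩ | ⟨a, ha, rfl⟩
  · exact ⟨_, isNaturalSeries_bSeries a, ha, rfl⟩
  · exact ⟨_, isNaturalSeries_pSeries a, ha, rfl⟩

/-! ### The cotangent lift of a partitioned system -/

section CotangentLift

variable {X Y : Type} [NormedAddCommGroup X] [NormedSpace ℝ X]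
  [NormedAddCommGroup Y] [NormedSpace ℝ Y] {p r : ℕ}

/-- A coordinate of a basis, as a continuous functional. -/
noncomputable def Module.Basis.coordL {Z ι : Type} [NormedAddCommGroup Z] [NormedSpace ℝ Z]
    [FiniteDimensional ℝ Z] (b : Module.Basis ι ℝ Z) (i : ι) : Z →L[ℝ] ℝ :=
  LinearMap.toContinuousLinearMap (b.coord i)

theorem Module.Basis.coordL_apply {Z ι : Type} [NormedAddCommGroup Z] [NormedSpace ℝ Z]
    [FiniteDimensional ℝ Z] (b : Module.Basis ι ℝ Z) (i : ι) (z : Z) :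
    b.coordL i z = b.repr z i := rfl

theorem Module.Basis.sum_coordL {Z ι : Type} [NormedAddCommGroup Z] [NormedSpace ℝ Z]
    [FiniteDimensional ℝ Z] [Fintype ι] (b : Module.Basis ι ℝ Z) (z : Z) :
    ∑ i, b.coordL i z • b i = z := b.sum_repr z

variable (bX : Module.Basis (Fin p) ℝ X) (bY : Module.Basis (Fin r) ℝ Y)

/-- The positions of the cotangent lift are `(x, y*)`; this is the projection to `x`. -/
noncomputable def liftProjFst : (Fin (p + r) → ℝ) →L[ℝ] X :=
  ∑ i : Fin p, (ContinuousLinearMap.proj (R := ℝ) (Fin.castAdd r i)).smulRight (bX i)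

/-- The momenta of the cotangent lift are `(x*, -y)`; this is the projection to `y`. -/
noncomputable def liftProjSnd : (Fin (p + r) → ℝ) →L[ℝ] Y :=
  -∑ j : Fin r, (ContinuousLinearMap.proj (R := ℝ) (Fin.natAdd p j)).smulRight (bY j)

/-- The projection of the cotangent lift to the base. -/
noncomputable def liftProj : CanonicalSpace (p + r) →L[ℝ] X × Y :=
  (liftProjFst bX).prodMap (liftProjSnd bY)

theorem liftProj_apply (z : CanonicalSpace (p + r)) : liftProj bX bY z =
    (∑ i, z.1 (Fin.castAdd r i) • bX i, -∑ j, z.2 (Fin.natAdd p j) • bY j) := by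
  have h : liftProj bX bY z = (liftProjFst bX z.1, liftProjSnd bY z.2) := rfl
  simp [h, liftProjFst, liftProjSnd]

variable [FiniteDimensional ℝ X] [FiniteDimensional ℝ Y]

/-- The embedding `x ↦ (x, D(x, ·))` into the positions. -/
noncomputable def liftInclFst (D : X →L[ℝ] Y →L[ℝ] ℝ) : X →L[ℝ] (Fin (p + r) → ℝ) :=
  ContinuousLinearMap.pi (Fin.addCases (fun i => bX.coordL i) (fun j => D.flip (bY j)))

/-- The embedding `y ↦ (D(·, y), -y)` into the momenta. -/
noncomputable def liftInclSnd (D : X →L[ℝ] Y →L[ℝ] ℝ) : Y →L[ℝ] (Fin (p + r) → ℝ) :=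
  ContinuousLinearMap.pi (Fin.addCases (fun i => D (bX i)) (fun j => -bY.coordL j))

/-- The section of the cotangent lift defined by the differential of `D`. -/
noncomputable def liftIncl (D : X →L[ℝ] Y →L[ℝ] ℝ) : X × Y →L[ℝ] CanonicalSpace (p + r) :=
  (liftInclFst bX bY D).prodMap (liftInclSnd bX bY D)

/-- The pairing of the fibre coordinates with a tangent vector of the base. -/
noncomputable def liftPairing : CanonicalSpace (p + r) →L[ℝ] (X × Y →L[ℝ] ℝ) :=
  ∑ i : Fin p, ((ContinuousLinearMap.proj (R := ℝ) (Fin.castAdd r i)).comp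
      (ContinuousLinearMap.snd ℝ _ _)).smulRight ((bX.coordL i).comp (ContinuousLinearMap.fst ℝ X Y))
    + ∑ j : Fin r, ((ContinuousLinearMap.proj (R := ℝ) (Fin.natAdd p j)).comp
      (ContinuousLinearMap.fst ℝ _ _)).smulRight ((bY.coordL j).comp (ContinuousLinearMap.snd ℝ X Y))

/-- The Hamiltonian of the cotangent lift of `f`. -/
noncomputable def liftHamiltonian (f : X × Y → X × Y) (z : CanonicalSpace (p + r)) : ℝ :=
  liftPairing bX bY z (f (liftProj bX bY z))

theorem liftPairing_apply (z : CanonicalSpace (p + r)) (v : X × Y) : liftPairing bX bY z v =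
    ∑ i, z.2 (Fin.castAdd r i) * bX.coordL i v.1 +
      ∑ j, z.1 (Fin.natAdd p j) * bY.coordL j v.2 := by
  simp [liftPairing]

theorem liftIncl_fst_castAdd (D : X →L[ℝ] Y →L[ℝ] ℝ) (v : X × Y) (i : Fin p) :
    (liftIncl bX bY D v).1 (Fin.castAdd r i) = bX.coordL i v.1 := by
  simp [liftIncl, liftInclFst]

theorem liftIncl_fst_natAdd (D : X →L[ℝ] Y →L[ℝ] ℝ) (v : X × Y) (j : Fin r) :
    (liftIncl bX bY D v).1 (Fin.natAdd p j) = D v.1 (bY j) := by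
  simp [liftIncl, liftInclFst]

theorem liftIncl_snd_castAdd (D : X →L[ℝ] Y →L[ℝ] ℝ) (v : X × Y) (i : Fin p) :
    (liftIncl bX bY D v).2 (Fin.castAdd r i) = D (bX i) v.2 := by
  simp [liftIncl, liftInclSnd]

theorem liftIncl_snd_natAdd (D : X →L[ℝ] Y →L[ℝ] ℝ) (v : X × Y) (j : Fin r) :
    (liftIncl bX bY D v).2 (Fin.natAdd p j) = -bY.coordL j v.2 := by
  simp [liftIncl, liftInclSnd]

theorem liftProj_liftIncl (D : X →L[ℝ] Y →L[ℝ] ℝ) (v : X × Y) :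
    liftProj bX bY (liftIncl bX bY D v) = v := by
  simp [liftProj_apply, liftIncl_fst_castAdd, liftIncl_snd_natAdd, Module.Basis.sum_coordL]

theorem liftPairing_liftIncl (D : X →L[ℝ] Y →L[ℝ] ℝ) (v w : X × Y) :
    liftPairing bX bY (liftIncl bX bY D v) w = D w.1 v.2 + D v.1 w.2 := by
  rw [liftPairing_apply]
  congr 1
  · conv_rhs => rw [← bX.sum_coordL w.1]
    simp [liftIncl_snd_castAdd, mul_comm]
  · conv_rhs => rw [← bY.sum_coordL w.2]
    simp [liftIncl_fst_natAdd, mul_comm]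

variable {f : X × Y → X × Y}

theorem contDiff_liftHamiltonian (hf : ContDiff ℝ ∞ f) :
    ContDiff ℝ ∞ (liftHamiltonian bX bY f) :=
  (liftPairing bX bY).contDiff.clm_apply (hf.comp (liftProj bX bY).contDiff)

theorem fderiv_liftHamiltonian (hf : ContDiff ℝ ∞ f) (z u : CanonicalSpace (p + r)) :
    fderiv ℝ (liftHamiltonian bX bY f) z u = liftPairing bX bY u (f (liftProj bX bY z)) +
      liftPairing bX bY z (fderiv ℝ f (liftProj bX bY z) (liftProj bX bY u)) := by
  have h1 : HasFDerivAt (fun z => f (liftProj bX bY z))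
      ((fderiv ℝ f (liftProj bX bY z)).comp (liftProj bX bY)) z :=
    ((hf.differentiable (by simp)) _).hasFDerivAt.comp z (liftProj bX bY).hasFDerivAt
  have h2 := ((liftPairing bX bY).hasFDerivAt (x := z)).clm_apply h1
  have h3 : fderiv ℝ (liftHamiltonian bX bY f) z = _ := h2.fderiv
  rw [h3]
  simp [add_comm]

/-- The base moves by `f` and the fibre by minus the transpose of its derivative. Taking `-y` as the
momentum conjugate to `y*` puts `x` among the positions and `y` among the momenta, so the partition
of the base agrees with the canonical one, as P-series require. -/
theorem hamiltonianField_liftHamiltonian (hf : ContDiff ℝ ∞ f) (z : CanonicalSpace (p + r)) :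
    (∀ i, (hamiltonianField (liftHamiltonian bX bY f) z).1 (Fin.castAdd r i) =
      bX.coordL i (f (liftProj bX bY z)).1) ∧
    (∀ j, (hamiltonianField (liftHamiltonian bX bY f) z).1 (Fin.natAdd p j) =
      -liftPairing bX bY z (fderiv ℝ f (liftProj bX bY z) (0, bY j))) ∧
    (∀ i, (hamiltonianField (liftHamiltonian bX bY f) z).2 (Fin.castAdd r i) =
      -liftPairing bX bY z (fderiv ℝ f (liftProj bX bY z) (bX i, 0))) ∧
    (∀ j, (hamiltonianField (liftHamiltonian bX bY f) z).2 (Fin.natAdd p j) =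
      -bY.coordL j (f (liftProj bX bY z)).2) := by
  have e1 : ∀ i i' : Fin p, (Pi.single (Fin.castAdd r i) (1 : ℝ) : Fin (p + r) → ℝ)
      (Fin.castAdd r i') = if i' = i then 1 else 0 := fun i i' => by
    simp [Pi.single_apply]
  have e2 : ∀ j j' : Fin r, (Pi.single (Fin.natAdd p j) (1 : ℝ) : Fin (p + r) → ℝ)
      (Fin.natAdd p j') = if j' = j then 1 else 0 := fun i i' => by
    simp [Pi.single_apply]
  have e3 : ∀ (i : Fin p) (j : Fin r), (Pi.single (Fin.castAdd r i) (1 : ℝ) : Fin (p + r) → ℝ)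
      (Fin.natAdd p j) = 0 := fun i j => by
    rw [Pi.single_apply, if_neg]; intro h; simp [Fin.ext_iff] at h; omega
  have e4 : ∀ (i : Fin p) (j : Fin r), (Pi.single (Fin.natAdd p j) (1 : ℝ) : Fin (p + r) → ℝ)
      (Fin.castAdd r i) = 0 := fun i j => by
    rw [Pi.single_apply, if_neg]; intro h; simp [Fin.ext_iff] at h; omega
  have p1 : ∀ i : Fin p, liftProj bX bY (0, Pi.single (Fin.castAdd r i) 1) = 0 := fun i => by
    simp [liftProj_apply, e3]
  have p2 : ∀ j : Fin r, liftProj bX bY (0, Pi.single (Fin.natAdd p j) 1) = -(0, bY j) :=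
    fun j => by simp [liftProj_apply, e2]
  have p3 : ∀ i : Fin p, liftProj bX bY (Pi.single (Fin.castAdd r i) 1, 0) = (bX i, 0) :=
    fun i => by simp [liftProj_apply, e1]
  have p4 : ∀ j : Fin r, liftProj bX bY (Pi.single (Fin.natAdd p j) 1, 0) = 0 := fun j => by
    simp [liftProj_apply, e4]
  refine ⟨fun i => ?_, fun j => ?_, fun i => ?_, fun j => ?_⟩
  · simp only [hamiltonianField, fderiv_liftHamiltonian bX bY hf, p1, map_zero, add_zero]
    simp [liftPairing_apply, e1]
  · simp only [hamiltonianField, fderiv_liftHamiltonian bX bY hf, p2, map_neg]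
    simp [liftPairing_apply bX bY (0, _), e4]
  · simp only [hamiltonianField, fderiv_liftHamiltonian bX bY hf, p3]
    simp [liftPairing_apply bX bY (_, 0), e3]
  · simp only [hamiltonianField, fderiv_liftHamiltonian bX bY hf, p4, map_zero, add_zero]
    simp [liftPairing_apply, e2]

/-- The section defined by the differential of an invariant is invariant under the lifted flow. -/
theorem liftIncl_intertwines (hf : ContDiff ℝ ∞ f) (D : X →L[ℝ] Y →L[ℝ] ℝ)
    (hD : ∀ v, D (f v).1 v.2 + D v.1 (f v).2 = 0) (v : X × Y) :
    liftIncl bX bY D (f v) =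
      hamiltonianField (liftHamiltonian bX bY f) (liftIncl bX bY D v) := by
  -- This is the derivative of the invariance identity `hD` at `v` in the direction `w`.
  have key : ∀ w : X × Y, D (fderiv ℝ f v w).1 v.2 + D v.1 (fderiv ℝ f v w).2 =
      -(D (f v).1 w.2 + D w.1 (f v).2) := by
    intro w
    have hf' := (hf.differentiable (by simp) v).hasFDerivAt
    have h1 := (D.hasFDerivAt.comp v hf'.fst).clm_apply (hasFDerivAt_snd (p := v) (𝕜 := ℝ))
    have h2 := (D.hasFDerivAt.comp v (hasFDerivAt_fst (p := v) (𝕜 := ℝ))).clm_apply hf'.snd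
    have h3 := (h1.add h2).unique
      ((hasFDerivAt_const (0 : ℝ) v).congr_of_eventuallyEq (Eventually.of_forall hD))
    have h4 := congrArg (fun T => T w) h3
    simp at h4
    linarith
  obtain ⟨h1, h2, h3, h4⟩ := hamiltonianField_liftHamiltonian bX bY hf (liftIncl bX bY D v)
  simp only [liftProj_liftIncl, liftPairing_liftIncl, key] at h1 h2 h3 h4
  refine Prod.ext (funext (Fin.addCases (fun i => ?_) fun j => ?_))
    (funext (Fin.addCases (fun i => ?_) fun j => ?_))
  · rw [h1, liftIncl_fst_castAdd]
  · rw [h2, liftIncl_fst_natAdd]; simp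
  · rw [h3, liftIncl_snd_castAdd]; simp
  · rw [h4, liftIncl_snd_natAdd]

end CotangentLift

/-! ### Linearity of the lift in the fibres. -/

section FibreScaling

variable {X Y : Type} [NormedAddCommGroup X] [NormedSpace ℝ X] [FiniteDimensional ℝ X]
  [NormedAddCommGroup Y] [NormedSpace ℝ Y] [FiniteDimensional ℝ Y] {p r : ℕ}
  (bX : Module.Basis (Fin p) ℝ X) (bY : Module.Basis (Fin r) ℝ Y)

/-- The part of a point of the cotangent lift in the fibre direction. -/
noncomputable def fibrePart (z : CanonicalSpace (p + r)) : CanonicalSpace (p + r) :=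
  z - liftIncl bX bY 0 (liftProj bX bY z)

/-- Multiplication of the fibre coordinates by `t`, on the positions. -/
noncomputable def fibreScaleFst (t : ℝ) : (Fin (p + r) → ℝ) →L[ℝ] (Fin (p + r) → ℝ) :=
  ContinuousLinearMap.id ℝ _ + (t - 1) •
    (ContinuousLinearMap.id ℝ _ - (liftInclFst bX bY 0).comp (liftProjFst bX))

/-- Multiplication of the fibre coordinates by `t`, on the momenta. -/
noncomputable def fibreScaleSnd (t : ℝ) : (Fin (p + r) → ℝ) →L[ℝ] (Fin (p + r) → ℝ) :=
  ContinuousLinearMap.id ℝ _ + (t - 1) •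
    (ContinuousLinearMap.id ℝ _ - (liftInclSnd bX bY 0).comp (liftProjSnd bY))

theorem fibreScale_apply (t : ℝ) (z : CanonicalSpace (p + r)) :
    (fibreScaleFst bX bY t).prodMap (fibreScaleSnd bX bY t) z =
      z + (t - 1) • fibrePart bX bY z := rfl

theorem fibrePart_apply (z : CanonicalSpace (p + r)) :
    (∀ i, (fibrePart bX bY z).1 (Fin.castAdd r i) = 0) ∧
    (∀ j, (fibrePart bX bY z).1 (Fin.natAdd p j) = z.1 (Fin.natAdd p j)) ∧
    (∀ i, (fibrePart bX bY z).2 (Fin.castAdd r i) = z.2 (Fin.castAdd r i)) ∧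
    (∀ j, (fibrePart bX bY z).2 (Fin.natAdd p j) = 0) := by
  refine ⟨fun i => ?_, fun j => ?_, fun i => ?_, fun j => ?_⟩
  · simp only [fibrePart, Prod.fst_sub, Pi.sub_apply, liftIncl_fst_castAdd]
    simp [liftProj_apply, Module.Basis.coordL_apply, Finsupp.single_apply]
  · simp only [fibrePart, Prod.fst_sub, Pi.sub_apply, liftIncl_fst_natAdd]
    simp
  · simp only [fibrePart, Prod.snd_sub, Pi.sub_apply, liftIncl_snd_castAdd]
    simp
  · simp only [fibrePart, Prod.snd_sub, Pi.sub_apply, liftIncl_snd_natAdd]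
    simp [liftProj_apply, Module.Basis.coordL_apply, Finsupp.single_apply]

theorem liftProj_fibrePart (z : CanonicalSpace (p + r)) :
    liftProj bX bY (fibrePart bX bY z) = 0 := by
  rw [fibrePart, map_sub, liftProj_liftIncl, sub_self]

theorem liftPairing_fibrePart (z : CanonicalSpace (p + r)) :
    liftPairing bX bY (fibrePart bX bY z) = liftPairing bX bY z := by
  ext v <;> simp [liftPairing_apply, fibrePart_apply bX bY z]

variable {f : X × Y → X × Y}

/-- The lifted Hamiltonian is linear in the fibre: the base velocity does not involve the fibre
coordinates, and the fibre velocity is linear in them. -/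
theorem fibreScale_intertwines (hf : ContDiff ℝ ∞ f) (t : ℝ) (z : CanonicalSpace (p + r)) :
    (fibreScaleFst bX bY t).prodMap (fibreScaleSnd bX bY t)
        (hamiltonianField (liftHamiltonian bX bY f) z) =
      hamiltonianField (liftHamiltonian bX bY f)
        ((fibreScaleFst bX bY t).prodMap (fibreScaleSnd bX bY t) z) := by
  simp only [fibreScale_apply]
  set F := hamiltonianField (liftHamiltonian bX bY f) with hF
  obtain ⟨h1, h2, h3, h4⟩ := hamiltonianField_liftHamiltonian bX bY hf z
  obtain ⟨g1, g2, g3, g4⟩ := hamiltonianField_liftHamiltonian bX bY hf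
    (z + (t - 1) • fibrePart bX bY z)
  obtain ⟨p1, p2, p3, p4⟩ := fibrePart_apply bX bY (F z)
  simp only [← hF, map_add, map_smul, liftProj_fibrePart, liftPairing_fibrePart, smul_zero,
    add_zero] at h1 h2 h3 h4 g1 g2 g3 g4
  refine Prod.ext (funext (Fin.addCases (fun i => ?_) fun j => ?_))
    (funext (Fin.addCases (fun i => ?_) fun j => ?_))
  · rw [g1]; simp [p1, h1]
  · rw [g2]; simp [p2, h2]; ring
  · rw [g3]; simp [p3, h3]; ring
  · rw [g4]; simp [p4, h4]

/-- A fibre vector pairs only with the base part of the other argument, which is `v`; what remains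
is the differential of `D(x, y)` at `w` along `v`. -/
theorem canonicalForm_liftIncl_fibrePart (D : X →L[ℝ] Y →L[ℝ] ℝ) (v w : X × Y) :
    canonicalForm (liftIncl bX bY D v) (fibrePart bX bY (liftIncl bX bY D w)) =
      D v.1 w.2 + D w.1 v.2 := by
  obtain ⟨p1, p2, p3, p4⟩ := fibrePart_apply bX bY (liftIncl bX bY D w)
  rw [← liftPairing_liftIncl bX bY D w v, liftPairing_apply]
  simp only [canonicalForm, Fin.sum_univ_add, p1, p2, p3, p4, liftIncl_fst_castAdd,
    liftIncl_snd_natAdd]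
  simp [mul_comm]

end FibreScaling

/-! ### Conservation of bilinear invariants. -/

theorem ContDiff.hamiltonianField {d : ℕ} {H : CanonicalSpace d → ℝ} (hH : ContDiff ℝ ∞ H) :
    ContDiff ℝ ∞ (hamiltonianField H) := by
  have h : ContDiff ℝ ∞ (fderiv ℝ H) := hH.fderiv_right (by simp)
  exact (contDiff_pi.2 fun i => h.clm_apply contDiff_const).prodMk
    (contDiff_pi.2 fun i => (h.clm_apply contDiff_const).neg)

/-- Euler's identity for homogeneous maps: differentiate the scaling relation at `t = 1`. -/
theorem fderiv_apply_of_scaling {E : Type} [NormedAddCommGroup E] [NormedSpace ℝ E]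
    {g V : E → E} {z : E} (hg : DifferentiableAt ℝ g z)
    (h : ∀ t : ℝ, g z + (t - 1) • V (g z) = g (z + (t - 1) • V z)) :
    fderiv ℝ g z (V z) = V (g z) := by
  have hl : ∀ x y : E, HasDerivAt (fun t : ℝ => x + (t - 1) • y) y 1 := fun x y => by
    simpa using (((hasDerivAt_id (1 : ℝ)).sub_const 1).smul_const y).const_add x
  have hz : z + ((1 : ℝ) - 1) • V z = z := by simp
  have h1 : HasDerivAt (fun t : ℝ => g (z + (t - 1) • V z)) (fderiv ℝ g z (V z)) 1 :=
    HasFDerivAt.comp_hasDerivAt_of_eq (1 : ℝ) hg.hasFDerivAt (hl z (V z)) hz.symm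
  exact h1.unique ((hl (g z) (V (g z))).congr_of_eventuallyEq
    (Eventually.of_forall fun t => (h t).symm))

/-- A symplectic B-series or P-series preserves bilinear invariants, as an identity of formal
power series. -/
theorem IsSymplecticSeriesOf.sum_antidiagonal_eq {X Y : Type} [NormedAddCommGroup X]
    [NormedSpace ℝ X] [FiniteDimensional ℝ X] [NormedAddCommGroup Y] [NormedSpace ℝ Y]
    [FiniteDimensional ℝ Y] {f : X × Y → X × Y} {c : ℕ → X × Y → X × Y}
    (hc : IsSymplecticSeriesOf f c) (hf : ContDiff ℝ ∞ f) (hf0 : f 0 = 0)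
    (D : X →L[ℝ] Y →L[ℝ] ℝ) (hD : ∀ v, D (f v).1 v.2 + D v.1 (f v).2 = 0) (k : ℕ) (v : X × Y) :
    ∑ p ∈ Finset.HasAntidiagonal.antidiagonal k, D (c p.1 v).1 (c p.2 v).2 =
      if k = 0 then D v.1 v.2 else 0 := by
  obtain ⟨S, hS, hsymp, rfl⟩ := hc.exists_isNaturalSeries
  rcases Nat.eq_zero_or_pos k with rfl | hk
  · simp [hS.zero]
  rw [if_neg hk.ne']
  let bX := Module.finBasis ℝ X
  let bY := Module.finBasis ℝ Y
  set H := liftHamiltonian bX bY f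
  have hH : ContDiff ℝ ∞ H := contDiff_liftHamiltonian bX bY hf
  have hF := hH.hamiltonianField
  have n2 : ∀ k v, liftIncl bX bY D (S _ _ f k v) =
      S _ _ (hamiltonianField H) k (liftIncl bX bY D v) :=
    hS.map _ _ _ _ _ _ hf hF _ _ (liftIncl_intertwines bX bY hf D hD)
  have n3 : ∀ (t : ℝ) k z, _ := fun t =>
    hS.map _ _ _ _ _ _ hF hF _ _ (fibreScale_intertwines bX bY hf t)
  -- Since `f 0 = 0`, the zero map intertwines `f` with itself; naturality for it gives the value at
  -- the origin.
  have n0 : ∀ k, S _ _ f k 0 = 0 := fun k => by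
    have := hS.map _ _ _ _ _ _ hf hf (0 : X →L[ℝ] X) (0 : Y →L[ℝ] Y) (fun z => hf0.symm) k 0
    exact this.symm
  have dc : ∀ k v, HasFDerivAt (S _ _ f k) (fderiv ℝ (S _ _ f k) v) v := fun k v =>
    (hS.differentiable _ _ _ hf k v).hasFDerivAt
  have dC := hS.differentiable _ _ _ hF
  have e2 : ∀ k v w, fderiv ℝ (S _ _ (hamiltonianField H) k) (liftIncl bX bY D v)
      (liftIncl bX bY D w) = liftIncl bX bY D (fderiv ℝ (S _ _ f k) v w) := fun k v w => by
    have h1 := (dC k (liftIncl bX bY D v)).hasFDerivAt.comp v (liftIncl bX bY D).hasFDerivAt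
    have h2 := (liftIncl bX bY D).hasFDerivAt.comp v (dc k v)
    have h3 := h1.unique (h2.congr_of_eventuallyEq
      (Eventually.of_forall fun v => (n2 k v).symm))
    exact congrArg (fun T => T w) h3
  have e3 : ∀ k v, fderiv ℝ (S _ _ (hamiltonianField H) k) (liftIncl bX bY D v)
      (fibrePart bX bY (liftIncl bX bY D v)) =
      fibrePart bX bY (liftIncl bX bY D (S _ _ f k v)) := fun k v => by
    rw [n2]
    exact fderiv_apply_of_scaling (dC k _) fun t => n3 t k _
  set g : X × Y → ℝ := fun v =>
    ∑ p ∈ Finset.HasAntidiagonal.antidiagonal k, D (S _ _ f p.1 v).1 (S _ _ f p.2 v).2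
  have hg : ∀ v, HasFDerivAt g 0 v := fun v => by
    have h1 := HasFDerivAt.fun_sum (u := Finset.HasAntidiagonal.antidiagonal k) fun p _ =>
      (D.hasFDerivAt.comp v (dc p.1 v).fst).clm_apply (dc p.2 v).snd
    refine h1.congr_fderiv (ContinuousLinearMap.ext fun w => ?_)
    have h2 := hsymp _ H hH (liftIncl bX bY D v) (liftIncl bX bY D w)
      (fibrePart bX bY (liftIncl bX bY D v)) k
    simp only [e2, e3, canonicalForm_liftIncl_fibrePart, if_neg hk.ne',
      Finset.sum_add_distrib] at h2
    -- One of the two product-rule terms appears with its indices exchanged; the symmetry of the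
    -- antidiagonal repairs this.
    rw [← Finset.Nat.sum_antidiagonal_swap (f := fun p => D (S _ _ f p.2 v).1 _)] at h2
    simpa [Finset.sum_add_distrib, add_comm] using h2
  have h0 : g 0 = 0 := Finset.sum_eq_zero fun p _ => by simp [n0]
  rw [← h0]
  exact is_const_of_fderiv_eq_zero (𝕜 := ℝ) (fun v => (hg v).differentiableAt)
    (fun v => (hg v).fderiv) v 0

/-! ### Products of convergent and of asymptotic series. -/

section Bilinear

variable {X Y G : Type} [NormedAddCommGroup X] [NormedSpace ℝ X] [NormedAddCommGroup Y]
  [NormedSpace ℝ Y] [NormedAddCommGroup G] [NormedSpace ℝ G] (T : X →L[ℝ] Y →L[ℝ] G)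

theorem isBigO_bilinear {ι : Type} {l : Filter ι} {u : ι → X} {v : ι → Y} {α β : ι → ℝ}
    (hu : u =O[l] α) (hv : v =O[l] β) : (fun h => T (u h) (v h)) =O[l] fun h => α h * β h :=
  (T.isBoundedBilinearMap.isBigO_comp (g := u) (h := v)).trans (hu.norm_left.mul hv.norm_left)

/-- A vector-valued version of `IsSymplecticSeriesOf.sum_antidiagonal_eq`. -/
theorem IsSymplecticSeriesOf.sum_antidiagonal_eq_vector [FiniteDimensional ℝ X]
    [FiniteDimensional ℝ Y] {f : X × Y → X × Y} {c : ℕ → X × Y → X × Y}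
    (hc : IsSymplecticSeriesOf f c) (hf : ContDiff ℝ ∞ f) (hf0 : f 0 = 0)
    (hT : ∀ v, T (f v).1 v.2 + T v.1 (f v).2 = 0) (k : ℕ) (v : X × Y) :
    ∑ p ∈ Finset.HasAntidiagonal.antidiagonal k, T (c p.1 v).1 (c p.2 v).2 =
      if k = 0 then T v.1 v.2 else 0 := by
  refine (SeparatingDual.eq_iff_forall_dual_eq (R := ℝ)).2 fun l => ?_
  have h := hc.sum_antidiagonal_eq hf hf0 ((ContinuousLinearMap.compL ℝ Y G ℝ l).comp T)
    (fun v => by simpa using congrArg l (hT v)) k v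
  rw [map_sum, apply_ite l, map_zero]
  exact h

/-- The Cauchy product of two series with respect to a bilinear map. -/
theorem bilinear_eq_of_hasSum [FiniteDimensional ℝ X] [FiniteDimensional ℝ Y] [CompleteSpace G]
    {x : ℕ → X} {y : ℕ → Y} {w : G} {h : ℝ} {x' : X} {y' : Y}
    (hx : HasSum (fun k => h ^ k • x k) x') (hy : HasSum (fun k => h ^ k • y k) y')
    (hT : ∀ k, ∑ p ∈ Finset.HasAntidiagonal.antidiagonal k, T (x p.1) (y p.2) =
      if k = 0 then w else 0) : T x' y' = w := by
  -- In finite dimensions summability is absolute, which justifies the rearrangement along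
  -- antidiagonals.
  have hs : Summable fun p : ℕ × ℕ => T (h ^ p.1 • x p.1) (h ^ p.2 • y p.2) := by
    have h1 := (hx.summable.norm.mul_of_nonneg hy.summable.norm (fun _ => norm_nonneg _)
      (fun _ => norm_nonneg _)).mul_left ‖T‖
    refine Summable.of_norm_bounded h1 fun p => ?_
    simpa [mul_assoc] using T.le_opNorm₂ (h ^ p.1 • x p.1) (h ^ p.2 • y p.2)
  have h1 : ∑' p : ℕ × ℕ, T (h ^ p.1 • x p.1) (h ^ p.2 • y p.2) = T x' y' := by
    rw [hs.tsum_prod' fun i => (T (h ^ i • x i)).summable hy.summable]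
    simp only [fun i => ((T (h ^ i • x i)).hasSum hy).tsum_eq]
    exact ((T.flip y').hasSum hx).tsum_eq
  have hs' := Finset.HasAntidiagonal.sigmaAntidiagonalEquivProd.summable_iff.2 hs
  rw [← h1, ← Finset.HasAntidiagonal.sigmaAntidiagonalEquivProd.tsum_eq]
  refine (Summable.tsum_sigma' (fun k => (hasSum_fintype _).summable) hs').trans ?_
  have h2 : ∀ k, ∑' p : Finset.HasAntidiagonal.antidiagonal k,
      T (h ^ p.1.1 • x p.1.1) (h ^ p.1.2 • y p.1.2) = if k = 0 then w else 0 := by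
    intro k
    rw [tsum_fintype, Finset.sum_coe_sort (Finset.HasAntidiagonal.antidiagonal k)
      (fun p => T (h ^ p.1 • x p.1) (h ^ p.2 • y p.2))]
    have h3 : ∀ p ∈ Finset.HasAntidiagonal.antidiagonal k,
        T (h ^ p.1 • x p.1) (h ^ p.2 • y p.2) = h ^ k • T (x p.1) (y p.2) := fun p hp => by
      rw [← Finset.HasAntidiagonal.mem_antidiagonal.1 hp, pow_add]
      simp [mul_smul, smul_comm (h ^ p.2)]
    rw [Finset.sum_congr rfl h3, ← Finset.smul_sum, hT]
    split_ifs with hk <;> simp [hk]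
  exact (tsum_congr h2).trans (tsum_ite_eq 0 fun _ => w)

theorem isBigO_pow_of_le {m k : ℕ} (hmk : m ≤ k) :
    (fun h : ℝ => h ^ k) =O[𝓝[>] 0] fun h : ℝ => h ^ m := by
  refine IsBigO.of_bound 1 ?_
  filter_upwards [Ioo_mem_nhdsGT (zero_lt_one' ℝ)] with h hh
  rw [one_mul, Real.norm_of_nonneg (pow_nonneg hh.1.le _),
    Real.norm_of_nonneg (pow_nonneg hh.1.le _)]
  exact pow_le_pow_of_le_one hh.1.le hh.2.le hmk

/-- The product of two asymptotic series with respect to a bilinear map. -/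
theorem bilinear_isBigO_of_asymptotic {x : ℕ → X} {y : ℕ → Y} {w : G} {u : ℝ → X} {v : ℝ → Y}
    (hu : ∀ N : ℕ, (fun h => u h - ∑ k ∈ Finset.range N, h ^ k • x k) =O[𝓝[>] 0]
      fun h : ℝ => h ^ N)
    (hv : ∀ N : ℕ, (fun h => v h - ∑ k ∈ Finset.range N, h ^ k • y k) =O[𝓝[>] 0]
      fun h : ℝ => h ^ N)
    (hT : ∀ k, ∑ p ∈ Finset.HasAntidiagonal.antidiagonal k, T (x p.1) (y p.2) =
      if k = 0 then w else 0) (N : ℕ) :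
    (fun h => T (u h) (v h) - w) =O[𝓝[>] 0] fun h : ℝ => h ^ N := by
  -- For `N = 0` the truncations are empty and miss the constant term `w`; this case follows from `N
  -- = 1`.
  suffices H : ∀ N : ℕ, 0 < N →
      (fun h => T (u h) (v h) - w) =O[𝓝[>] 0] fun h : ℝ => h ^ N from
    (H (N + 1) N.succ_pos).trans (isBigO_pow_of_le N.le_succ)
  intro N hN
  -- The expansion with no terms is boundedness.
  have hv0 : v =O[𝓝[>] 0] fun _ : ℝ => (1 : ℝ) := by simpa using hv 0
  have hu0 : u =O[𝓝[>] 0] fun _ : ℝ => (1 : ℝ) := by simpa using hu 0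
  have hU : (fun h => ∑ k ∈ Finset.range N, h ^ k • x k) =O[𝓝[>] 0] fun _ : ℝ => (1 : ℝ) := by
    have := hu0.sub ((hu N).trans (isBigO_pow_of_le N.zero_le))
    simpa using this
  have e1 := isBigO_bilinear T hU (hv N)
  have e2 := isBigO_bilinear T (hu N) hv0
  have e3 : (fun h : ℝ => T (∑ k ∈ Finset.range N, h ^ k • x k)
      (∑ k ∈ Finset.range N, h ^ k • y k) - w) =O[𝓝[>] 0] fun h : ℝ => h ^ N := by
    -- Below total degree `N` the product of the truncations contains full antidiagonals, whose sum
    -- is `w`; only degrees at least `N` are left.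
    have h1 : ∀ h : ℝ, T (∑ k ∈ Finset.range N, h ^ k • x k)
        (∑ k ∈ Finset.range N, h ^ k • y k) - w =
        ∑ p ∈ (Finset.range N ×ˢ Finset.range N) with ¬ p.1 + p.2 < N,
          h ^ (p.1 + p.2) • T (x p.1) (y p.2) := by
      intro h
      have h2 : T (∑ k ∈ Finset.range N, h ^ k • x k) (∑ k ∈ Finset.range N, h ^ k • y k) =
          ∑ p ∈ Finset.range N ×ˢ Finset.range N, h ^ (p.1 + p.2) • T (x p.1) (y p.2) := by
        rw [Finset.sum_product, map_sum T, sum_apply]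
        refine Finset.sum_congr rfl fun i _ => ?_
        rw [map_sum]
        refine Finset.sum_congr rfl fun j _ => ?_
        simp [pow_add, mul_smul, smul_comm (h ^ j)]
      rw [h2, ← Finset.sum_filter_add_sum_filter_not _ (fun p : ℕ × ℕ => p.1 + p.2 < N),
        ← Finset.sum_fiberwise_of_maps_to (t := Finset.range N)
          (g := fun p : ℕ × ℕ => p.1 + p.2) (by simp)]
      have h3 : ∀ k ∈ Finset.range N,
          ∑ p ∈ ((Finset.range N ×ˢ Finset.range N).filter
            (fun p : ℕ × ℕ => p.1 + p.2 < N)).filter (fun p => p.1 + p.2 = k),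
            h ^ (p.1 + p.2) • T (x p.1) (y p.2) = if k = 0 then w else 0 := by
        intro k hk
        replace hk := Finset.mem_range.1 hk
        have h4 : ((Finset.range N ×ˢ Finset.range N).filter
            (fun p : ℕ × ℕ => p.1 + p.2 < N)).filter (fun p => p.1 + p.2 = k) =
            Finset.HasAntidiagonal.antidiagonal k := by
          ext p
          simp only [Finset.mem_filter, Finset.mem_product, Finset.mem_range,
            Finset.HasAntidiagonal.mem_antidiagonal]
          omega
        rw [h4, Finset.sum_congr rfl fun p hp => by rw [Finset.HasAntidiagonal.mem_antidiagonal.1 hp],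
          ← Finset.smul_sum, hT]
        split_ifs with hk <;> simp [hk]
      rw [Finset.sum_congr rfl h3, Finset.sum_ite_eq' (Finset.range N) 0 (fun _ => w),
        if_pos (Finset.mem_range.2 hN), add_sub_cancel_left]
    simp only [h1]
    refine IsBigO.fun_sum fun p hp => ?_
    have hp' : N ≤ p.1 + p.2 := by simpa using (Finset.mem_filter.1 hp).2
    simpa using (isBigO_pow_of_le hp').smul (isBigO_refl (fun _ : ℝ => T (x p.1) (y p.2)) _)
      |>.trans ((isBigO_refl (fun h : ℝ => h ^ N) _).smul
        (isBigO_const_const (T (x p.1) (y p.2)) (one_ne_zero (α := ℝ)) _))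
  simp only [one_mul, mul_one] at e1 e2
  refine ((e1.add e2).add e3).congr_left fun h => ?_
  simp only [map_sub, sub_apply]
  abel

end Bilinear

theorem HasAsymptoticSeries.fst {E F : Type} [NormedAddCommGroup E] [NormedSpace ℝ E]
    [NormedAddCommGroup F] [NormedSpace ℝ F] {A : Set (E × F)} {Φ : ℝ → E × F → E × F}
    {c : ℕ → E × F → E × F} (h : HasAsymptoticSeries A Φ c) {z : E × F} (hz : z ∈ A) (N : ℕ) :
    (fun h => (Φ h z).1 - ∑ k ∈ Finset.range N, h ^ k • (c k z).1) =O[𝓝[>] 0]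
      fun h : ℝ => h ^ N :=
  (((ContinuousLinearMap.fst ℝ E F).isBigO_comp _ _).trans (h z hz N)).congr_left
    fun h => by simp [Prod.fst_sum]

theorem HasAsymptoticSeries.snd {E F : Type} [NormedAddCommGroup E] [NormedSpace ℝ E]
    [NormedAddCommGroup F] [NormedSpace ℝ F] {A : Set (E × F)} {Φ : ℝ → E × F → E × F}
    {c : ℕ → E × F → E × F} (h : HasAsymptoticSeries A Φ c) {z : E × F} (hz : z ∈ A) (N : ℕ) :
    (fun h => (Φ h z).2 - ∑ k ∈ Finset.range N, h ^ k • (c k z).2) =O[𝓝[>] 0]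
      fun h : ℝ => h ^ N :=
  (((ContinuousLinearMap.snd ℝ E F).isBigO_comp _ _).trans (h z hz N)).congr_left
    fun h => by simp [Prod.snd_sum]

theorem isLittleO_comp_hasFDerivAt {E F : Type} [NormedAddCommGroup E] [NormedSpace ℝ E]
    [NormedAddCommGroup F] [NormedSpace ℝ F] {g : E → F} {g' : E →L[ℝ] F} {y : ℝ → E} {z w : E}
    (hg : HasFDerivAt g g' z)
    (hy : (fun h => y h - z - h • w) =o[𝓝[>] 0] fun h : ℝ => h) :
    (fun h => g (y h) - g z - h • g' w) =o[𝓝[>] 0] fun h : ℝ => h := by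
  have hO : (fun h => y h - z) =O[𝓝[>] 0] fun h : ℝ => h := by
    have h1 : (fun h : ℝ => h • w) =O[𝓝[>] 0] fun h : ℝ => h := by
      simpa using (isBigO_refl (fun h : ℝ => h) (𝓝[>] 0)).smul
        (isBigO_const_const w (one_ne_zero (α := ℝ)) _)
    simpa using hy.isBigO.add h1
  have h0 : Tendsto (fun h : ℝ => h) (𝓝[>] 0) (𝓝 0) := tendsto_id.mono_left nhdsWithin_le_nhds
  have ht : Tendsto y (𝓝[>] 0) (𝓝 z) := by
    simpa using (hO.trans_tendsto h0).add_const z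
  have h1 := (hg.isLittleO.comp_tendsto ht).trans_isBigO hO
  have h2 := (g'.isBigO_comp (fun h => y h - z - h • w) (𝓝[>] (0 : ℝ))).trans_isLittleO hy
  refine (h1.add h2).congr_left fun h => ?_
  simp

/-! ### Matrix identities and estimates for the momentum map. -/

section Matrices

variable {n : ℕ}

/-- Conjugate transposition as a continuous real-linear map. -/
noncomputable def conjTransposeL (n : ℕ) : GLie n →L[ℝ] GLie n :=
  LinearMap.toContinuousLinearMap
    { toFun := fun A => Aᴴ
      map_add' := Matrix.conjTranspose_add
      map_smul' := fun r A => by simp [Matrix.conjTranspose_smul] }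

/-- Matrix multiplication as a continuous real-bilinear map. -/
noncomputable def matrixMulL (n : ℕ) : GLie n →L[ℝ] GLie n →L[ℝ] GLie n :=
  (LinearMap.mul ℝ (GLie n)).toContinuousBilinearMap

/-- The real-bilinear map `(Q, P) ↦ P Q†`. -/
noncomputable def mulConjTransposeL (n : ℕ) : GLie n →L[ℝ] GLie n →L[ℝ] GLie n :=
  (matrixMulL n).flip.comp (conjTransposeL n)

/-- The momentum map as a real-bilinear map. -/
noncomputable def momentumL (n : ℕ) : GLie n →L[ℝ] GLie n →L[ℝ] GLie n :=
  (matrixMulL n).comp (conjTransposeL n)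

theorem conjTransposeL_apply (A : GLie n) : conjTransposeL n A = Aᴴ := rfl

theorem mulConjTransposeL_apply (A B : GLie n) : mulConjTransposeL n A B = B * Aᴴ := rfl

theorem contDiff_momentum : ContDiff ℝ ∞ (momentum (n := n)) :=
  ((momentumL n).contDiff.comp contDiff_fst).clm_apply contDiff_snd

theorem fderiv_momentum (z w : GLie n × GLie n) :
    fderiv ℝ momentum z w = z.1ᴴ * w.2 + w.1ᴴ * z.2 := by
  have h := (momentumL n).isBoundedBilinearMap.hasFDerivAt z
  exact congrArg (fun L => L w) h.fderiv

theorem contDiff_liftedField {B : GLie n → GLie n} (hB : ContDiff ℝ ∞ B) :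
    ContDiff ℝ ∞ (liftedField B) := by
  have h := hB.comp (contDiff_momentum (n := n))
  exact (((matrixMulL n).contDiff.comp contDiff_fst).clm_apply
    ((conjTransposeL n).contDiff.comp h)).prodMk
    (((matrixMulL n).contDiff.comp contDiff_snd).clm_apply h).neg

theorem liftedField_zero (B : GLie n → GLie n) : liftedField B 0 = 0 := by
  simp [liftedField]

/-- `P Q†` is an invariant of the lifted system. -/
theorem mulConjTransposeL_liftedField (B : GLie n → GLie n) (z : GLie n × GLie n) :
    mulConjTransposeL n (liftedField B z).1 z.2 + mulConjTransposeL n z.1 (liftedField B z).2 =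
      0 := by
  simp [mulConjTransposeL_apply, liftedField, Matrix.mul_assoc]

/-- Acting by `Q⁻¹` moves a point to first component `1`, so `W ↦ (1, W)` is a section meeting every
orbit. -/
theorem leftAction_inv_mem {z : GLie n × GLie n} (hz : z ∈ cotangentGL n) :
    ∃ G : GL (Fin n) ℂ, leftAction G z = (1, momentum z) := by
  obtain ⟨U, hU⟩ : IsUnit z.1 := hz
  refine ⟨U⁻¹, ?_⟩
  simp [leftAction, momentum, ← hU]

theorem momentum_leftAction (G : GL (Fin n) ℂ) (z : GLie n × GLie n) :
    momentum (leftAction G z) = momentum z := by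
  have h : (G : GLie n)ᴴ * ((G⁻¹ : GL (Fin n) ℂ) : GLie n)ᴴ = 1 := by
    rw [← Matrix.conjTranspose_mul, Units.inv_mul, Matrix.conjTranspose_one]
  simp only [momentum, leftAction, Matrix.conjTranspose_mul]
  rw [Matrix.mul_assoc, ← Matrix.mul_assoc (G : GLie n)ᴴ, h, Matrix.one_mul]

theorem momentum_one (W : GLie n) : momentum ((1, W) : GLie n × GLie n) = W := by
  simp [momentum]

theorem fderiv_momentum_liftedField (B : GLie n → GLie n) (W : GLie n) :
    fderiv ℝ momentum ((1, W) : GLie n × GLie n) (liftedField B (1, W)) =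
      isospectralField B W := by
  refine (fderiv_momentum _ _).trans ?_
  simp only [liftedField, isospectralField, momentum_one, Matrix.conjTranspose_one,
    Matrix.conjTranspose_conjTranspose, Matrix.one_mul, neg_add_eq_sub]

theorem MvPolynomial.isBigO_eval_sub {l : Filter ℝ} {β : ℝ → ℝ}
    (hβ : β =O[l] fun _ => (1 : ℝ)) {σ : Type} {x : ℝ → σ → ℂ} {x₀ : σ → ℂ}
    (hx : ∀ i, (fun h => x h i - x₀ i) =O[l] β) (q : MvPolynomial σ ℂ) :
    (fun h => q.eval (x h) - q.eval x₀) =O[l] β := by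
  induction q using MvPolynomial.induction_on with
  | C a => simpa using isBigO_zero β l
  | add p q hp hq =>
    refine (hp.add hq).congr_left fun h => ?_
    simp only [map_add]; ring
  | mul_X p i hp =>
    have h1 : (fun h => x h i) =O[l] fun _ => (1 : ℝ) := by
      simpa using ((hx i).trans hβ).add (isBigO_const_const (x₀ i) (one_ne_zero (α := ℝ)) l)
    have h2 := hp.mul h1
    have h3 := (isBigO_const_const (p.eval x₀) (one_ne_zero (α := ℝ)) l).mul (hx i)
    simp only [mul_one, one_mul] at h2 h3
    refine (h2.add h3).congr_left fun h => ?_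
    simp only [map_mul, MvPolynomial.eval_X]; ring

theorem charpoly_coeff_isBigO {l : Filter ℝ} {β : ℝ → ℝ} (hβ : β =O[l] fun _ => (1 : ℝ))
    {M : ℝ → GLie n} {M₀ : GLie n} (hM : (fun h => M h - M₀) =O[l] β) (i : ℕ) :
    (fun h => (M h).charpoly.coeff i - M₀.charpoly.coeff i) =O[l] β := by
  have key : ∀ A : GLie n, MvPolynomial.eval (fun p : Fin n × Fin n => A p.1 p.2)
      ((Matrix.charpoly.univ ℂ (Fin n)).coeff i) = A.charpoly.coeff i := fun A =>
    Matrix.charpoly.univ_coeff_eval₂Hom (Fin n) (RingHom.id ℂ) (fun p => A p.1 p.2) i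
  simp only [← key]
  refine MvPolynomial.isBigO_eval_sub hβ (fun p => IsBigO.trans ?_ hM) _
  refine IsBigO.of_bound 1 (Eventually.of_forall fun h => ?_)
  rw [one_mul]
  exact Matrix.norm_entry_le_entrywise_sup_norm (M h - M₀)

/-- The normalizer is defined by an inclusion only; `X ↦ g⁻¹ X g` is injective on the
finite-dimensional `S`, hence onto, so the inverse conjugation also preserves `S`. -/
theorem groupNormalizer_conj_mem {S : Submodule ℝ (GLie n)} {g X : GLie n}
    (hg : g ∈ groupNormalizer S) (hX : X ∈ S) : g * X * g⁻¹ ∈ S := by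
  obtain ⟨hu, hS⟩ := hg
  have h2 := Matrix.mul_nonsing_inv g ((Matrix.isUnit_iff_isUnit_det g).1 hu)
  generalize g⁻¹ = g' at hS h2 ⊢
  have e : ∀ A : GLie n, g * (g' * A * g) * g' = A := fun A => by
    rw [← Matrix.mul_assoc, ← Matrix.mul_assoc, h2, Matrix.one_mul, Matrix.mul_assoc, h2,
      Matrix.mul_one]
  let L : S →ₗ[ℝ] S := (LinearMap.mulLeftRight ℝ (g', g)).restrict hS
  have hL : ∀ A : S, (L A : GLie n) = g' * (A : GLie n) * g := fun A => rfl
  have hinj : Function.Injective L := fun A A' h => Subtype.ext <| by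
    rw [← e A, ← e A', ← hL, ← hL, h]
  obtain ⟨Y, hY⟩ := LinearMap.injective_iff_surjective.1 hinj ⟨X, hX⟩
  have hY' : g' * (Y : GLie n) * g = X := (hL Y).symm.trans (congrArg Subtype.val hY)
  rw [← hY', e]
  exact Y.2

/-- With `g = Q†`, this splits `Q† P` into a conjugate of `W` and the conjugated defect of the
invariant `P Q†`. -/
theorem mul_eq_conj_add {g P W : GLie n} (hg : IsUnit g) :
    g * P = g * W * g⁻¹ + g * (P * g - W) * g⁻¹ := by
  have h2 := Matrix.mul_nonsing_inv g ((Matrix.isUnit_iff_isUnit_det g).1 hg)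
  rw [Matrix.mul_sub, Matrix.sub_mul, add_sub_cancel, ← Matrix.mul_assoc, Matrix.mul_assoc, h2,
    Matrix.mul_one]

theorem tendsto_one_of_asymptotic {Q : ℝ → GLie n} {x : ℕ → GLie n} (hx : x 0 = 1)
    (hQ : ∀ N : ℕ, (fun h => Q h - ∑ k ∈ Finset.range N, h ^ k • x k) =O[𝓝[>] 0]
      fun h : ℝ => h ^ N) : Tendsto Q (𝓝[>] 0) (𝓝 1) := by
  have h0 : Tendsto (fun h : ℝ => h ^ 1) (𝓝[>] 0) (𝓝 0) := by
    simp only [pow_one]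
    exact tendsto_id.mono_left nhdsWithin_le_nhds
  have h1 := ((hQ 1).trans_tendsto h0).add_const (1 : GLie n)
  simp only [Finset.sum_range_one, pow_zero, one_smul, hx, sub_add_cancel, zero_add] at h1
  exact h1

theorem conj_isBigO {l : Filter ℝ} {β : ℝ → ℝ} {g R : ℝ → GLie n} (hg : Tendsto g l (𝓝 1))
    (hR : R =O[l] β) : (fun h => g h * R h * (g h)⁻¹) =O[l] β := by
  have hinv : Tendsto (fun h => (g h)⁻¹) l (𝓝 1) := by
    have h1 : ContinuousAt Inv.inv (1 : GLie n) := continuousAt_matrix_inv _ (by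
      rw [Matrix.det_one, Ring.inverse_eq_inv']
      exact continuousAt_inv₀ one_ne_zero)
    have h2 := h1.tendsto.comp hg
    rwa [inv_one] at h2
  have h1 := isBigO_bilinear (matrixMulL n) (hg.isBigO_one ℝ) hR
  have h2 := isBigO_bilinear (matrixMulL n) h1 (hinv.isBigO_one ℝ)
  simp only [one_mul, mul_one] at h2
  exact h2

end Matrices

/-! ### Descent, isospectrality and restriction to subspaces. -/

theorem mainTheorem4 {n : ℕ} (B : GLie n → GLie n) (hB : ContDiff ℝ ∞ B)
    -- the B-series or P-series expansion of a symplectic method for the lifted system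
    (c : ℕ → GLie n × GLie n → GLie n × GLie n)
    (hc : IsSymplecticSeriesOf (liftedField B) c)
    -- the method, a family of maps from subsets of the cotangent bundle to the cotangent bundle;
    -- every point lies in the domain for all small step sizes
    (D : ℝ → Set (GLie n × GLie n)) (Φ : ℝ → GLie n × GLie n → GLie n × GLie n)
    (hD : ∀ h, D h ⊆ cotangentGL n)
    (hD0 : ∀ z ∈ cotangentGL n, ∀ᶠ h in 𝓝[>] (0 : ℝ), z ∈ D h)
    (hΦ : ∀ h, Set.MapsTo (Φ h) (D h) (cotangentGL n))
    -- equivariance under the left action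
    (hequiv : ∀ h, ∀ z ∈ D h, ∀ G : GL (Fin n) ℂ,
      leftAction G z ∈ D h ∧ Φ h (leftAction G z) = leftAction G (Φ h z)) :
    ∃ φ : ℝ → GLie n → GLie n,
      -- the method descends to `φ`
      (∀ h, ∀ z ∈ D h, φ h (momentum z) = momentum (Φ h z)) ∧
      -- `φ` is an integrator of the isospectral flow
      (IsConsistentOn (cotangentGL n) (liftedField B) Φ →
        IsConsistentOn Set.univ (isospectralField B) φ) ∧
      -- `φ` is isospectral: exactly, where the series converges to the method, and to all orders,
      -- where it is an asymptotic expansion of the method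
      (IsSumOfSeries D Φ c →
        ∀ h, ∀ W ∈ momentum '' D h, (φ h W).charpoly = W.charpoly) ∧
      (HasAsymptoticSeries (cotangentGL n) Φ c →
        ∀ (W : GLie n) (i N : ℕ),
          (fun h => (φ h W).charpoly.coeff i - W.charpoly.coeff i) =O[𝓝[>] 0]
            (fun h : ℝ => h ^ N)) ∧
      -- restriction to a subspace `S` on which the isospectral flow evolves
      (∀ S : Submodule ℝ (GLie n),
        (∃ ε > 0, ∀ W ∈ Metric.thickening ε (S : Set (GLie n)), B W ∈ lieNormalizer S) →
        (∀ h, ∀ z ∈ D h, momentum z ∈ S → ∀ G : GL (Fin n) ℂ,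
          z.1 ∈ leaf S G → (Φ h z).1 ∈ leaf S G) →
        (IsSumOfSeries D Φ c →
          ∀ h, ∀ W ∈ momentum '' D h, W ∈ S → φ h W ∈ S) ∧
        (HasAsymptoticSeries (cotangentGL n) Φ c →
          ∀ W ∈ S, ∀ N : ℕ,
            (fun h => Metric.infDist (φ h W) (S : Set (GLie n))) =O[𝓝[>] 0]
              (fun h : ℝ => h ^ N))) := by
  set T := mulConjTransposeL n
  have hzero : ∀ z, c 0 z = z := fun z => by
    obtain ⟨S, hS, -, rfl⟩ := hc.exists_isNaturalSeries
    exact hS.zero _ _ _ z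
  have hformal : ∀ (W : GLie n) (k : ℕ), ∑ p ∈ Finset.HasAntidiagonal.antidiagonal k,
      T (c p.1 (1, W)).1 (c p.2 (1, W)).2 = if k = 0 then W else 0 := fun W k =>
    (hc.sum_antidiagonal_eq_vector T (contDiff_liftedField hB) (liftedField_zero B)
      (mulConjTransposeL_liftedField B) k (1, W)).trans
      (congrArg (fun X => if k = 0 then X else 0) ((mulConjTransposeL_apply _ _).trans (by simp)))
  have hmem : ∀ W : GLie n, ((1, W) : GLie n × GLie n) ∈ cotangentGL n := fun W => isUnit_one
  have hbase : ∀ h, ∀ z ∈ D h, ((1, momentum z) : GLie n × GLie n) ∈ D h ∧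
      momentum (Φ h (1, momentum z)) = momentum (Φ h z) := by
    intro h z hz
    obtain ⟨G, hG⟩ := leftAction_inv_mem (hD h hz)
    obtain ⟨h1, h2⟩ := hequiv h z hz G
    rw [hG] at h1 h2
    exact ⟨h1, by rw [h2, momentum_leftAction]⟩
  have hexact : IsSumOfSeries D Φ c → ∀ h, ∀ W : GLie n, ((1, W) : GLie n × GLie n) ∈ D h →
      (Φ h (1, W)).2 * (Φ h (1, W)).1ᴴ = W := by
    intro hs h W hW
    have h1 := hs h _ hW
    exact bilinear_eq_of_hasSum T (h1.mapL (ContinuousLinearMap.fst ℝ _ _))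
      (h1.mapL (ContinuousLinearMap.snd ℝ _ _))
      (hformal W)
  have hasymp : HasAsymptoticSeries (cotangentGL n) Φ c → ∀ (W : GLie n) (N : ℕ),
      (fun h => (Φ h (1, W)).2 * (Φ h (1, W)).1ᴴ - W) =O[𝓝[>] 0] fun h : ℝ => h ^ N :=
    fun ha W N => bilinear_isBigO_of_asymptotic T (ha.fst (hmem W)) (ha.snd (hmem W))
      (hformal W) N
  have hnormalizer : ∀ S : Submodule ℝ (GLie n),
      (∀ h, ∀ z ∈ D h, momentum z ∈ S → ∀ G : GL (Fin n) ℂ,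
        z.1 ∈ leaf S G → (Φ h z).1 ∈ leaf S G) →
      ∀ h, ∀ W ∈ S, ((1, W) : GLie n × GLie n) ∈ D h →
        (Φ h (1, W)).1ᴴ ∈ groupNormalizer S := by
    intro S hS h W hW hWD
    -- The identity lies on the leaf with `G = 1`, and membership of `Q` in that leaf means `Q† ∈
    -- N(S)`.
    have h1 := hS h _ hWD (by rwa [momentum_one]) 1 (by simp [leaf, groupNormalizer])
    simpa [leaf] using h1
  refine ⟨fun h W => momentum (Φ h (1, W)), fun h z hz => (hbase h z hz).2, ?_, ?_, ?_, ?_⟩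
  · intro hcons W _
    have hd := (contDiff_momentum.differentiable (by simp)
      ((1, W) : GLie n × GLie n)).hasFDerivAt
    refine (isLittleO_comp_hasFDerivAt hd (hcons _ (hmem W))).congr_left fun h => ?_
    exact congrArg₂ (fun X Y => momentum (Φ h (1, W)) - X - h • Y) (momentum_one W)
      (fderiv_momentum_liftedField B W)
  · rintro hs h _ ⟨z, hz, rfl⟩
    change ((Φ h (1, momentum z)).1ᴴ * (Φ h (1, momentum z)).2).charpoly = _
    -- `Q† P` and `P Q†` have the same characteristic polynomial, and the latter product is `W`.
    rw [Matrix.charpoly_mul_comm, hexact hs h _ (hbase h z hz).1]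
  · intro ha W i N
    simp only [momentum, Matrix.charpoly_mul_comm _ (Prod.snd _)]
    exact charpoly_coeff_isBigO (by simpa using isBigO_pow_of_le N.zero_le) (hasymp ha W N) i
  · intro S _ hS
    refine ⟨?_, fun ha W hW N => ?_⟩
    · rintro hs h _ ⟨z, hz, rfl⟩ hW
      have hzD := (hbase h z hz).1
      have hg := hnormalizer S hS h _ hW hzD
      change (Φ h (1, momentum z)).1ᴴ * (Φ h (1, momentum z)).2 ∈ S
      rw [mul_eq_conj_add (W := momentum z) hg.1, hexact hs h _ hzD, sub_self,
        Matrix.mul_zero, Matrix.zero_mul, add_zero]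
      exact groupNormalizer_conj_mem hg hW
    · have hg1 : Tendsto (fun h => (Φ h (1, W)).1ᴴ) (𝓝[>] 0) (𝓝 1) := by
        have h1 := tendsto_one_of_asymptotic (by rw [hzero]) (ha.fst (hmem W))
        have h2 := ((conjTransposeL n).continuous.tendsto 1).comp h1
        rwa [conjTransposeL_apply, Matrix.conjTranspose_one] at h2
      -- The conjugate `g W g⁻¹` is a point of `S`, so the distance is at most the norm of the
      -- conjugated defect, which stays `O(h^N)` because `g → 1`.
      refine IsBigO.trans (IsBigO.of_bound 1 ?_) (conj_isBigO hg1 (hasymp ha W N))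
      filter_upwards [hD0 _ (hmem W)] with h hh
      have hg := hnormalizer S hS h W hW hh
      rw [one_mul, Real.norm_of_nonneg Metric.infDist_nonneg]
      refine (Metric.infDist_le_dist_of_mem (groupNormalizer_conj_mem hg hW)).trans_eq ?_
      rw [momentum, mul_eq_conj_add (W := W) hg.1, dist_eq_norm, add_sub_cancel_left]
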